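/- Let $(W,S)$ be a Coxeter system with $W$ finite, and let $o$ be the identity of $W$. For nonnegative rates $\mathbf r=(r_s)_{s\in S}$, consider the continuous-time random walk on $W$ that starts at $o$ and jumps from its current position $x$ to $xs$ at each ring of a Poisson clock of rate $r_s$, the clocks being independent for different $s\in S$; let $p_t(x,y;\mathbf r)$ be its transition probabilities. Let $\mathbf r,\mathbf r'$ be two sets of nonnegative rates with $r_s\le r'_s$ for all $s\in S$, and let $t>0$. Then $f:=p_t(o,\cdot\,;\mathbf r)$ majorizes $f':=p_t(o,\cdot\,;\mathbf r')$; that is, with $f_{[1]}\ge\dots\ge f_{[n]}$ and $f'_{[1]}\ge\dots\ge f'_{[n]}$ the decreasing rearrangements ($n=|W|$), $f_{[1]}+\dots+f_{[i]}\ge f'_{[1]}+\dots+f'_{[i]}$ for $1\le i\le n$, with equality for $i=n$. If $\mathbf r\ne\mathbf r'$, the majorization is strict: $f'$ does not majorize $f$. Consequently, with $u\equiv 1/n$ the uniform distribution on $W$: $\|f'-u\|_p\le\|f-u\|_p$ for every $p\in[1,\infty]$; $\bigl(\tfrac12\sum_v|\sqrt{f'(v)}-\sqrt{u(v)}|^2\bigr)^{1/2}\le\bigl(\tfrac12\sum_v|\sqrt{f(v)}-\sqrt{u(v)}|^2\bigr)^{1/2}$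 (Hellinger distance); and $-\sum_v f(v)\log f(v)\le-\sum_v f'(v)\log f'(v)$ (entropy). If $\mathbf r\ne\mathbf r'$, then the $\ell^p$ inequalities with $1<p<\infty$, the Hellinger inequality and the entropy inequality are strict. -/

import Mathlib

namespace CoxeterWalk

section Majorization

variable {ι : Type*} [Fintype ι]

/-- An enumeration of the index set `ι` along which the values of `f` decrease. -/
noncomputable def sortEnum (f : ι → ℝ) : Fin (Fintype.card ι) ≃ ι :=
  (Tuple.sort (fun i => -f ((Fintype.equivFin ι).symm i))).trans (Fintype.equivFin ι).symm

/-- The decreasing rearrangement `f_[1] ≥ f_[2] ≥ ⋯ ≥ f_[n]` of `f`, indexed from `0` here. -/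
noncomputable def decRearr (f : ι → ℝ) (i : Fin (Fintype.card ι)) : ℝ :=
  f (sortEnum f i)

theorem decRearr_antitone (f : ι → ℝ) : Antitone (decRearr f) := by
  intro i j hij
  have h := Tuple.monotone_sort (fun i => -f ((Fintype.equivFin ι).symm i)) hij
  simpa [decRearr, sortEnum] using h

/-- `f_[1] + ⋯ + f_[k]`, the sum of the `k` largest entries of `f` (for `k ≤ n`). -/
noncomputable def topSum (f : ι → ℝ) (k : ℕ) : ℝ :=
  ∑ i : Fin (Fintype.card ι) with i.val < k, decRearr f i

/-- `f` majorizes `g`: each partial sum of the decreasing rearrangement of `f` is at least the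
one of `g`, with equality for the total sums. -/
def Majorizes (f g : ι → ℝ) : Prop :=
  (∀ k ≤ Fintype.card ι, topSum g k ≤ topSum f k) ∧
    topSum f (Fintype.card ι) = topSum g (Fintype.card ι)

/-- `f` majorizes `g` strictly: `g` does not majorize `f` in turn (that is, `f` and `g` are not
rearrangements of each other). -/
def StrictlyMajorizes (f g : ι → ℝ) : Prop :=
  Majorizes f g ∧ ¬ Majorizes g f

/-- The `ℓ^p`-distance, for real `p ≥ 1`. -/
noncomputable def lpDist (p : ℝ) (f g : ι → ℝ) : ℝ :=
  (∑ v, |f v - g v| ^ p) ^ (1 / p)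

/-- The `ℓ^∞`-distance (a maximum, as `ι` is finite). -/
noncomputable def linftyDist (f g : ι → ℝ) : ℝ :=
  ⨆ v, |f v - g v|

/-- The Hellinger distance. -/
noncomputable def hellingerDist (f g : ι → ℝ) : ℝ :=
  Real.sqrt (1 / 2 * ∑ v, |Real.sqrt (f v) - Real.sqrt (g v)| ^ 2)

/-- The entropy `∑ -f(v) log f(v)` (with `0 log 0 = 0`). -/
noncomputable def entropy (f : ι → ℝ) : ℝ :=
  ∑ v, -(f v * Real.log (f v))

/-- The uniform distribution on `ι`. -/
noncomputable def uniform (ι : Type*) [Fintype ι] : ι → ℝ :=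
  fun _ => 1 / (Fintype.card ι : ℝ)

end Majorization

section Walk

variable {B W : Type*} [Group W] [Fintype B] [Fintype W] [DecidableEq W] {M : CoxeterMatrix B}

/-- The generator (matrix of jump rates) of the walk that moves from its current position `x` to
`x * s` whenever the Poisson clock of the simple reflection `s`, of rate `r s`, rings. -/
noncomputable def generator (cs : CoxeterSystem M W) (r : B → ℝ) : Matrix W W ℝ :=
  Matrix.of fun x y =>
    ∑ s : B, r s * ((if y = x * cs.simple s then 1 else 0) - (if y = x then 1 else 0))

/-- The transition probability `p_t(x, y; r)` of the continuous-time random walk on `W`: the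
`(x, y)` entry of `exp (t Q)`, where `Q` is the generator. -/
noncomputable def transProb (cs : CoxeterSystem M W) (r : B → ℝ) (t : ℝ) (x y : W) : ℝ :=
  NormedSpace.exp (t • generator cs r) x y

end Walk

end CoxeterWalk

open CoxeterWalk

/-!
The walk spreads out downwards in Bruhat order. Let `K` be the closed convex cone of functions on
`W` that decrease in this order. It is preserved by `1 + R_s`, where `R_s` is the right translation
by a simple reflection `s`, because `x` and `x s` are separated by exactly one wall, whose
reflection swaps them. Up to a scalar matrix the generator is a nonnegative combination of these
operators, so the semigroups `P_u` and `P'_u` of the two walks preserve `K`, and the distributions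
`p_u` and `p'_u` of the two walks started at the identity belong to `K`.

For `c` in `K`, the derivative of `u ↦ ⟨p_u, P'_{t-u} c⟩` is the Dirichlet form, with rates
`r' - r`, of two functions in `K`. Both decrease along each edge in the same direction, so the form
is nonnegative and `⟨p'_t, c⟩ ≤ ⟨p_t, c⟩`. With `c = ψ ∘ p'_t` for monotone `ψ` this is
majorization; with `c = p'_t` and `r ≠ r'` it is strict and makes the sum of squares drop. The
remaining inequalities are Karamata's, for the convex functions `|x - 1/n| ^ p`, `(√x - √(1/n))²`
and `x log x`.

The Bruhat order only enters through the comparisons across one wall, and the side of a wall on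
which an element lies is read off from Tits' action of `W` on `W × ZMod 2`, without lengths.
-/

namespace CoxeterWalk

section TopSum

variable {ι : Type*} [Fintype ι]

theorem sum_comp_decRearr (f : ι → ℝ) (φ : ℝ → ℝ) : ∑ i, φ (decRearr f i) = ∑ v, φ (f v) :=
  Equiv.sum_comp (sortEnum f) fun v => φ (f v)

theorem topSum_zero (f : ι → ℝ) : topSum f 0 = 0 := by
  simp [topSum]

theorem topSum_card (f : ι → ℝ) : topSum f (Fintype.card ι) = ∑ v, f v := by
  rw [topSum, Finset.filter_true_of_mem fun i _ => i.2]
  exact sum_comp_decRearr f id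

theorem topSum_succ (f : ι → ℝ) (i : Fin (Fintype.card ι)) :
    topSum f (i + 1) = topSum f i + decRearr f i := by
  have h : Finset.univ.filter (fun j : Fin (Fintype.card ι) => j.val < i.val + 1) =
      insert i (Finset.univ.filter fun j : Fin (Fintype.card ι) => j.val < i.val) := by
    ext j
    simp only [Finset.mem_filter, Finset.mem_univ, true_and, Finset.mem_insert, Fin.ext_iff]
    omega
  rw [topSum, h, Finset.sum_insert (by simp), add_comm]
  rfl

theorem topSum_eq_add_sum_sub (f : ι → ℝ) {k : ℕ} (hk : k ≤ Fintype.card ι) (b : ℝ) :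
    topSum f k = k * b + ∑ i : Fin (Fintype.card ι) with i.val < k, (decRearr f i - b) := by
  rw [Finset.sum_sub_distrib, Finset.sum_const, Fin.card_filter_val_lt, min_eq_right hk,
    nsmul_eq_mul, add_sub_cancel, topSum]

theorem topSum_le_add_sum_max (f : ι → ℝ) {k : ℕ} (hk : k ≤ Fintype.card ι) (b : ℝ) :
    topSum f k ≤ k * b + ∑ v, max (f v - b) 0 := by
  rw [topSum_eq_add_sum_sub f hk b, ← sum_comp_decRearr f fun x => max (x - b) 0]
  gcongr
  calc ∑ i : Fin (Fintype.card ι) with i.val < k, (decRearr f i - b)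
      ≤ ∑ i : Fin (Fintype.card ι) with i.val < k, max (decRearr f i - b) 0 :=
        Finset.sum_le_sum fun i _ => le_max_left _ _
    _ ≤ ∑ i, max (decRearr f i - b) 0 :=
        Finset.sum_le_univ_sum_of_nonneg fun i => le_max_right _ _

theorem topSum_succ_eq_add_sum_max (f : ι → ℝ) (i : Fin (Fintype.card ι)) :
    topSum f (i + 1) = (i + 1 : ℕ) * decRearr f i + ∑ v, max (f v - decRearr f i) 0 := by
  rw [topSum_eq_add_sum_sub f i.2 (decRearr f i),
    ← sum_comp_decRearr f fun x => max (x - decRearr f i) 0, Finset.sum_filter]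
  congr 1
  refine Finset.sum_congr rfl fun j _ => ?_
  split_ifs with hj
  · exact (max_eq_left (sub_nonneg.2 (decRearr_antitone f (Nat.lt_succ_iff.1 hj)))).symm
  · exact (max_eq_right (sub_nonpos.2 (decRearr_antitone f (by omega)))).symm

variable {f g : ι → ℝ}

theorem majorizes_of_sum_max_sub_le
    (hmax : ∀ b, ∑ v, max (g v - b) 0 ≤ ∑ v, max (f v - b) 0) (hsum : ∑ v, f v = ∑ v, g v) :
    Majorizes f g := by
  refine ⟨fun k hk => ?_, by rw [topSum_card, topSum_card, hsum]⟩
  obtain _ | k := k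
  · rw [topSum_zero, topSum_zero]
  · rw [topSum_succ_eq_add_sum_max f ⟨k, hk⟩]
    grw [topSum_le_add_sum_max g hk (decRearr f ⟨k, hk⟩), hmax]

-- Taking for `ψ` the indicator of `(b, ∞)` bounds the sum of `max (g - b) 0`.
theorem majorizes_of_forall_monotone
    (h : ∀ ψ : ℝ → ℝ, Monotone ψ → ∑ v, g v * ψ (g v) ≤ ∑ v, f v * ψ (g v)) :
    Majorizes f g := by
  have hsum : ∑ v, f v = ∑ v, g v := by
    have hone := h (fun _ => 1) monotone_const
    have hneg := h (fun _ => -1) monotone_const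
    simp only [mul_one, mul_neg, Finset.sum_neg_distrib] at hone hneg
    linarith
  refine majorizes_of_sum_max_sub_le (fun b => ?_) hsum
  let ψ : ℝ → ℝ := (Set.Ioi b).indicator fun _ => 1
  have hψ : Monotone ψ := by
    intro x y hxy
    by_cases hx : b < x
    · simp [ψ, hx, hx.trans_le hxy]
    · simpa [ψ, hx] using Set.indicator_nonneg (fun _ _ => zero_le_one) y
  calc ∑ v, max (g v - b) 0
      = ∑ v, g v * ψ (g v) - ∑ v, b * ψ (g v) := by
        rw [← Finset.sum_sub_distrib]
        refine Finset.sum_congr rfl fun v _ => ?_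
        rcases lt_or_ge b (g v) with hv | hv
        · simp [ψ, hv, hv.le]
        · simp [ψ, hv, hv.not_gt]
    _ ≤ ∑ v, f v * ψ (g v) - ∑ v, b * ψ (g v) := sub_le_sub_right (h ψ hψ) _
    _ ≤ ∑ v, max (f v - b) 0 := by
        rw [← Finset.sum_sub_distrib]
        refine Finset.sum_le_sum fun v _ => ?_
        by_cases hv : b < g v <;> simp [ψ, hv]

end TopSum

section Karamata

theorem mul_le_sum_mul_sub_of_antitone {n : ℕ} {c : Fin n → ℝ} (hc : Antitone c) {T : ℕ → ℝ}
    (hT₀ : T 0 = 0) (hT : ∀ k ≤ n, 0 ≤ T k) {b : ℝ} (hb : ∀ i, b ≤ c i) :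
    b * T n ≤ ∑ i, c i * (T (i + 1) - T i) := by
  induction n generalizing b with
  | zero => simp [hT₀]
  | succ n ih =>
    have hinit := ih (c := fun i => c i.castSucc) (fun i j hij => hc hij)
      (fun k hk => hT k (by omega)) (b := c (Fin.last n)) fun i => hc (Fin.le_last _)
    have hlast := mul_le_mul_of_nonneg_right (hb (Fin.last n)) (hT (n + 1) le_rfl)
    rw [Fin.sum_univ_castSucc]
    simp only [Fin.val_castSucc, Fin.val_last] at hinit ⊢
    linarith

theorem Majorizes.sum_mul_decRearr_le {ι : Type*} [Fintype ι] {f g : ι → ℝ} (h : Majorizes f g)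
    {c : Fin (Fintype.card ι) → ℝ} (hc : Antitone c) :
    ∑ i, c i * decRearr g i ≤ ∑ i, c i * decRearr f i := by
  obtain ⟨b, hb⟩ := (Set.finite_range c).bddBelow
  have habel := mul_le_sum_mul_sub_of_antitone hc (T := fun k => topSum f k - topSum g k)
    (by simp only [topSum_zero, sub_self]) (fun k hk => sub_nonneg.2 (h.1 k hk))
    fun i => hb ⟨i, rfl⟩
  rw [h.2, sub_self, mul_zero] at habel
  rw [← sub_nonneg, ← Finset.sum_sub_distrib]
  refine habel.trans_eq (Finset.sum_congr rfl fun i _ => ?_)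
  rw [topSum_succ, topSum_succ]
  ring

variable {D : Set ℝ} {φ : ℝ → ℝ}

-- The restriction to a finite set has finite slopes even where `φ` has none, as at an endpoint
-- of `D`. The slope chosen at `y` is the least one towards a larger point of `T`, capped by `K`.
theorem exists_monotoneOn_subgradient (hφ : ConvexOn ℝ D φ) {T : Finset ℝ} (hT : ↑T ⊆ D) :
    ∃ c : ℝ → ℝ, MonotoneOn c T ∧ ∀ y ∈ T, ∀ x ∈ T, c y * (x - y) ≤ φ x - φ y := by
  obtain ⟨K, hK⟩ : ∃ K : ℝ, ∀ x ∈ T, ∀ y ∈ T, slope φ x y ≤ K := by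
    obtain ⟨K, hK⟩ := (T.image₂ (slope φ) T).exists_le
    exact ⟨K, fun x hx y hy => hK _ (Finset.mem_image₂_of_mem hx hy)⟩
  let c : ℝ → ℝ := fun y => (T.filter (y < ·)).fold min K (slope φ y)
  have c_le_slope {y z : ℝ} (hz : z ∈ T) (hyz : y < z) : c y ≤ slope φ y z :=
    ((Finset.le_fold_min _).1 le_rfl).2 z (Finset.mem_filter.2 ⟨hz, hyz⟩)
  have slope_le_c {x y : ℝ} (hx : x ∈ T) (hy : y ∈ T) (hxy : x < y) : slope φ x y ≤ c y := by
    refine (Finset.le_fold_min _).2 ⟨hK x hx y hy, fun z hz => ?_⟩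
    obtain ⟨hzT, hyz⟩ := Finset.mem_filter.1 hz
    simpa only [slope_def_field] using hφ.slope_mono_adjacent (hT hx) (hT hzT) hxy hyz
  refine ⟨c, fun y hy z hz hyz => ?_, fun y hy x hx => ?_⟩
  · rcases hyz.eq_or_lt with rfl | hlt
    · exact le_rfl
    · exact (c_le_slope hz hlt).trans (slope_le_c hy hz hlt)
  · rcases lt_trichotomy x y with hxy | rfl | hyx
    · have hslope := slope_le_c hx hy hxy
      rw [slope_def_field, div_le_iff₀ (sub_pos.2 hxy)] at hslope
      linarith
    · simp
    · have hslope := c_le_slope hx hyx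
      rwa [slope_def_field, le_div_iff₀ (sub_pos.2 hyx)] at hslope

section Preorder

variable {ι : Type*} [Fintype ι] [Preorder ι] {a b : ι → ℝ}

theorem sum_le_sum_of_convexOn (hφ : ConvexOn ℝ D φ) (ha : ∀ i, a i ∈ D) (hb : ∀ i, b i ∈ D)
    (hanti : Antitone b) (hab : ∀ c : ι → ℝ, Antitone c → ∑ i, c i * b i ≤ ∑ i, c i * a i) :
    ∑ i, φ (b i) ≤ ∑ i, φ (a i) := by
  let T := Finset.univ.image a ∪ Finset.univ.image b
  have haT : ∀ i, a i ∈ T := fun i =>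
    Finset.mem_union_left _ (Finset.mem_image_of_mem a (Finset.mem_univ i))
  have hbT : ∀ i, b i ∈ T := fun i =>
    Finset.mem_union_right _ (Finset.mem_image_of_mem b (Finset.mem_univ i))
  have hT : ↑T ⊆ D := by
    simp [T, Set.union_subset_iff, Set.range_subset_iff, ha, hb]
  obtain ⟨c, hc, hsub⟩ := exists_monotoneOn_subgradient hφ hT
  have hcb := hab (fun i => c (b i)) fun i j hij => hc (hbT j) (hbT i) (hanti hij)
  rw [← sub_nonneg, ← Finset.sum_sub_distrib] at hcb ⊢
  refine hcb.trans (Finset.sum_le_sum fun i _ => ?_)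
  rw [← mul_sub]
  exact hsub _ (hbT i) _ (haT i)

-- The hypothesis `hab` is inherited by the midpoint of `a` and `b`, and strict convexity
-- separates the midpoint from `a`.
theorem sum_lt_sum_of_strictConvexOn (hφ : StrictConvexOn ℝ D φ) (ha : ∀ i, a i ∈ D)
    (hb : ∀ i, b i ∈ D) (hanti : Antitone b)
    (hab : ∀ c : ι → ℝ, Antitone c → ∑ i, c i * b i ≤ ∑ i, c i * a i) (hne : a ≠ b) :
    ∑ i, φ (b i) < ∑ i, φ (a i) := by
  let m : ι → ℝ := fun i => (1 / 2 : ℝ) • a i + (1 / 2 : ℝ) • b i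
  have hbm : ∑ i, φ (b i) ≤ ∑ i, φ (m i) := by
    refine sum_le_sum_of_convexOn hφ.convexOn
      (fun i => hφ.1 (ha i) (hb i) (by norm_num) (by norm_num) (by norm_num)) hb hanti
      fun c hc => ?_
    have hm : ∑ i, c i * m i = 1 / 2 * ∑ i, c i * a i + 1 / 2 * ∑ i, c i * b i := by
      simp only [m, smul_eq_mul, Finset.mul_sum, ← Finset.sum_add_distrib]
      exact Finset.sum_congr rfl fun i _ => by ring
    linarith [hab c hc]
  have hma : ∑ i, φ (m i) < ∑ i, (1 / 2 * φ (a i) + 1 / 2 * φ (b i)) := by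
    obtain ⟨j, hj⟩ := Function.ne_iff.1 hne
    exact Finset.sum_lt_sum
      (fun i _ => hφ.convexOn.2 (ha i) (hb i) (by norm_num) (by norm_num) (by norm_num))
      ⟨j, Finset.mem_univ j,
        hφ.2 (ha j) (hb j) hj (by norm_num) (by norm_num) (by norm_num)⟩
  rw [Finset.sum_add_distrib, ← Finset.mul_sum, ← Finset.mul_sum] at hma
  linarith

end Preorder

variable {ι : Type*} [Fintype ι] {f g : ι → ℝ}

theorem Majorizes.sum_le_sum (h : Majorizes f g) (hφ : ConvexOn ℝ D φ) (hf : ∀ v, f v ∈ D)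
    (hg : ∀ v, g v ∈ D) : ∑ v, φ (g v) ≤ ∑ v, φ (f v) := by
  rw [← sum_comp_decRearr f, ← sum_comp_decRearr g]
  exact sum_le_sum_of_convexOn hφ (fun i => hf _) (fun i => hg _) (decRearr_antitone g)
    fun _ => h.sum_mul_decRearr_le

theorem StrictlyMajorizes.sum_lt_sum (h : StrictlyMajorizes f g) (hφ : StrictConvexOn ℝ D φ)
    (hf : ∀ v, f v ∈ D) (hg : ∀ v, g v ∈ D) : ∑ v, φ (g v) < ∑ v, φ (f v) := by
  have hne : decRearr f ≠ decRearr g := fun heq =>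
    h.2 (by simp only [Majorizes, topSum, heq, le_refl, implies_true, and_self])
  rw [← sum_comp_decRearr f, ← sum_comp_decRearr g]
  exact sum_lt_sum_of_strictConvexOn hφ (fun i => hf _) (fun i => hg _) (decRearr_antitone g)
    (fun _ => h.1.sum_mul_decRearr_le) hne

theorem Majorizes.strictlyMajorizes_of_sum_lt (h : Majorizes f g) (hφ : ConvexOn ℝ Set.univ φ)
    (hlt : ∑ v, φ (g v) < ∑ v, φ (f v)) : StrictlyMajorizes f g :=
  ⟨h, fun hgf =>
    hlt.not_ge (hgf.sum_le_sum hφ (fun _ => Set.mem_univ _) fun _ => Set.mem_univ _)⟩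

end Karamata

section Convexity

variable {E : Type*} [NormedAddCommGroup E] [NormedSpace ℝ E] {p : ℝ}

theorem convexOn_norm_rpow (hp : 1 ≤ p) : ConvexOn ℝ Set.univ fun x : E => ‖x‖ ^ p := by
  refine ⟨convex_univ, fun x hx y hy a b ha hb hab => ?_⟩
  calc ‖a • x + b • y‖ ^ p
      ≤ (a • ‖x‖ + b • ‖y‖) ^ p := by gcongr; exact convexOn_univ_norm.2 hx hy ha hb hab
    _ ≤ a • ‖x‖ ^ p + b • ‖y‖ ^ p :=
      (convexOn_rpow hp).2 (norm_nonneg x) (norm_nonneg y) ha hb hab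

theorem strictConvexOn_norm_rpow [StrictConvexSpace ℝ E] (hp : 1 < p) :
    StrictConvexOn ℝ Set.univ fun x : E => ‖x‖ ^ p := by
  have hp₀ : 0 < p := one_pos.trans hp
  refine ⟨convex_univ, fun x hx y hy hxy a b ha hb hab => ?_⟩
  by_cases hnorm : ‖x‖ = ‖y‖
  · calc ‖a • x + b • y‖ ^ p
        < ‖y‖ ^ p := Real.rpow_lt_rpow (norm_nonneg _)
          (norm_combo_lt_of_ne hnorm.le le_rfl hxy ha hb hab) hp₀
      _ = a • ‖x‖ ^ p + b • ‖y‖ ^ p := by rw [hnorm, Convex.combo_self hab]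
  · calc ‖a • x + b • y‖ ^ p
        ≤ (a • ‖x‖ + b • ‖y‖) ^ p := by gcongr; exact convexOn_univ_norm.2 hx hy ha.le hb.le hab
      _ < a • ‖x‖ ^ p + b • ‖y‖ ^ p :=
        (strictConvexOn_rpow hp).2 (norm_nonneg x) (norm_nonneg y) hnorm ha hb hab

theorem convexOn_abs_sub_rpow (hp : 1 ≤ p) (c : ℝ) :
    ConvexOn ℝ Set.univ fun x : ℝ => |x - c| ^ p :=
  (convexOn_norm_rpow hp).translate_left (-c)

theorem strictConvexOn_abs_sub_rpow (hp : 1 < p) (c : ℝ) :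
    StrictConvexOn ℝ Set.univ fun x : ℝ => |x - c| ^ p :=
  (strictConvexOn_norm_rpow hp).translate_left (-c)

theorem abs_sqrt_sub_sq {x : ℝ} (hx : 0 ≤ x) (c : ℝ) :
    |√x - c| ^ 2 = x + c ^ 2 - 2 * c * √x := by
  rw [sq_abs, sub_sq, Real.sq_sqrt hx]
  ring

theorem convexOn_abs_sqrt_sub_sq {c : ℝ} (hc : 0 ≤ c) :
    ConvexOn ℝ (Set.Ici 0) fun x : ℝ => |√x - c| ^ 2 :=
  (((convexOn_id (convex_Ici 0)).add_const (c ^ 2)).sub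
    (Real.strictConcaveOn_sqrt.concaveOn.smul (c := 2 * c) (by positivity))).congr
      fun _ hx => (abs_sqrt_sub_sq hx c).symm

theorem strictConcaveOn_const_mul_sqrt {c : ℝ} (hc : 0 < c) :
    StrictConcaveOn ℝ (Set.Ici 0) fun x : ℝ => c * √x := by
  refine ⟨convex_Ici 0, fun x hx y hy hxy a b ha hb hab => ?_⟩
  have hsqrt := mul_lt_mul_of_pos_left (Real.strictConcaveOn_sqrt.2 hx hy hxy ha hb hab) hc
  simpa only [smul_eq_mul, mul_add, mul_left_comm c] using hsqrt

theorem strictConvexOn_abs_sqrt_sub_sq {c : ℝ} (hc : 0 < c) :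
    StrictConvexOn ℝ (Set.Ici 0) fun x : ℝ => |√x - c| ^ 2 :=
  (((convexOn_id (convex_Ici 0)).add_const (c ^ 2)).sub_strictConcaveOn
    (strictConcaveOn_const_mul_sqrt (c := 2 * c) (by positivity))).congr
      fun _ hx => (abs_sqrt_sub_sq hx c).symm

end Convexity

section Distances

variable {ι : Type*} [Fintype ι] {f g : ι → ℝ} {p : ℝ}

theorem Majorizes.lpDist_le (h : Majorizes f g) (hp : 1 ≤ p) (c : ℝ) :
    lpDist p g (fun _ => c) ≤ lpDist p f fun _ => c := by
  have hsum := h.sum_le_sum (convexOn_abs_sub_rpow hp c) (fun _ => Set.mem_univ _)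
    fun _ => Set.mem_univ _
  exact Real.rpow_le_rpow (by positivity) hsum (by positivity)

theorem StrictlyMajorizes.lpDist_lt (h : StrictlyMajorizes f g) (hp : 1 < p) (c : ℝ) :
    lpDist p g (fun _ => c) < lpDist p f fun _ => c := by
  have hsum := h.sum_lt_sum (strictConvexOn_abs_sub_rpow hp c) (fun _ => Set.mem_univ _)
    fun _ => Set.mem_univ _
  exact Real.rpow_lt_rpow (by positivity) hsum (by positivity)

-- The convex function `max (|x - c| - S) 0`, with `S` the distance of `f`, has sum `0` along `f`.
theorem Majorizes.linftyDist_le (h : Majorizes f g) (c : ℝ) :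
    linftyDist g (fun _ => c) ≤ linftyDist f fun _ => c := by
  set S := linftyDist f fun _ => c
  have hfS : ∀ v, |f v - c| ≤ S := le_ciSup (Set.finite_range fun v => |f v - c|).bddAbove
  let φ : ℝ → ℝ := fun x => max (|x - c| - S) 0
  have hφ : ConvexOn ℝ Set.univ φ :=
    ((convexOn_univ_dist c).sub (concaveOn_const S convex_univ)).sup
      (convexOn_const 0 convex_univ)
  have hφf : ∀ v, φ (f v) = 0 := fun v => max_eq_right (sub_nonpos.2 (hfS v))
  have hφg : ∑ v, φ (g v) ≤ 0 := by
    simpa only [hφf, Finset.sum_const_zero] using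
      h.sum_le_sum hφ (fun _ => Set.mem_univ _) fun _ => Set.mem_univ _
  refine Real.iSup_le (fun v => ?_) (Real.iSup_nonneg fun v => abs_nonneg _)
  have hv : φ (g v) ≤ ∑ v, φ (g v) :=
    Finset.single_le_sum (f := fun v => φ (g v)) (fun _ _ => le_max_right _ _) (Finset.mem_univ v)
  exact sub_nonpos.1 ((le_max_left _ _).trans (hv.trans hφg))

theorem Majorizes.hellingerDist_le (h : Majorizes f g) (hf : ∀ v, 0 ≤ f v) (hg : ∀ v, 0 ≤ g v)
    (c : ℝ) : hellingerDist g (fun _ => c) ≤ hellingerDist f fun _ => c := by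
  have hsum := h.sum_le_sum (convexOn_abs_sqrt_sub_sq (Real.sqrt_nonneg c)) hf hg
  exact Real.sqrt_le_sqrt (by gcongr)

theorem StrictlyMajorizes.hellingerDist_lt (h : StrictlyMajorizes f g) (hf : ∀ v, 0 ≤ f v)
    (hg : ∀ v, 0 ≤ g v) {c : ℝ} (hc : 0 < c) :
    hellingerDist g (fun _ => c) < hellingerDist f fun _ => c := by
  have hsum := h.sum_lt_sum (strictConvexOn_abs_sqrt_sub_sq (Real.sqrt_pos.2 hc)) hf hg
  exact Real.sqrt_lt_sqrt (by positivity) (by gcongr)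

theorem Majorizes.entropy_le (h : Majorizes f g) (hf : ∀ v, 0 ≤ f v) (hg : ∀ v, 0 ≤ g v) :
    entropy f ≤ entropy g := by
  have hsum := h.sum_le_sum Real.convexOn_mul_log hf hg
  simpa only [entropy, Finset.sum_neg_distrib, neg_le_neg_iff] using hsum

theorem StrictlyMajorizes.entropy_lt (h : StrictlyMajorizes f g) (hf : ∀ v, 0 ≤ f v)
    (hg : ∀ v, 0 ≤ g v) : entropy f < entropy g := by
  have hsum := h.sum_lt_sum Real.strictConvexOn_mul_log hf hg
  simpa only [entropy, Finset.sum_neg_distrib, neg_lt_neg_iff] using hsum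

end Distances

section Reflections

theorem conj_mul_pow_eq_iff {G : Type*} [Group G] {a b : G} (ha : a * a = 1) (hb : b * b = 1)
    (j k : ℕ) (t : G) :
    (a * b) ^ k * t * ((a * b) ^ k)⁻¹ = b * (a * b) ^ j ↔ t = b * (a * b) ^ (j + 2 * k) := by
  have hinv : (a * b)⁻¹ = b * a := by
    rw [mul_inv_rev, inv_eq_of_mul_eq_one_left ha, inv_eq_of_mul_eq_one_left hb]
  have hsemi : SemiconjBy b ((a * b) ^ k) ((a * b)⁻¹ ^ k) := by
    refine SemiconjBy.pow_right ?_ k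
    rw [SemiconjBy, hinv, mul_assoc]
  rw [mul_inv_eq_iff_eq_mul, ← eq_inv_mul_iff_mul_eq, ← inv_pow, ← mul_assoc, ← mul_assoc,
    ← hsemi.eq, mul_assoc, mul_assoc, ← pow_add, ← pow_add]
  ring_nf

variable {G : Type*} [Group G] [DecidableEq G]

/-- The permutation `(t, ε) ↦ (s t s⁻¹, ε + [t = s])` of `G × ZMod 2`. For the simple reflections
of a Coxeter system these permutations satisfy the Coxeter relations; the second component then
counts, modulo 2, how often a product of simple reflections crosses the wall of `t`. -/
def signedConj (s : G) : Equiv.Perm (G × ZMod 2) where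
  toFun p := (s * p.1 * s⁻¹, p.2 + if p.1 = s then 1 else 0)
  invFun p := (s⁻¹ * p.1 * s, p.2 + if p.1 = s then 1 else 0)
  left_inv p := by
    have hfix : s * p.1 * s⁻¹ = s ↔ p.1 = s := by rw [mul_inv_eq_iff_eq_mul, mul_right_inj]
    simp only [hfix, add_assoc, CharTwo.add_self_eq_zero]
    simp [mul_assoc]
  right_inv p := by
    have hfix : s⁻¹ * p.1 * s = s ↔ p.1 = s := by rw [mul_eq_right, inv_mul_eq_one, eq_comm]
    simp only [hfix, add_assoc, CharTwo.add_self_eq_zero]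
    simp [mul_assoc]

theorem signedConj_apply (s : G) (p : G × ZMod 2) :
    signedConj s p = (s * p.1 * s⁻¹, p.2 + if p.1 = s then 1 else 0) := rfl

theorem signedConj_mul_pow_apply {a b : G} (ha : a * a = 1) (hb : b * b = 1) (k : ℕ)
    (t : G) (e : ZMod 2) :
    ((signedConj a * signedConj b) ^ k) (t, e) =
      ((a * b) ^ k * t * ((a * b) ^ k)⁻¹,
        e + ∑ i ∈ Finset.range (2 * k), if t = b * (a * b) ^ i then 1 else 0) := by
  induction k with
  | zero => simp
  | succ k ih =>
    have hfst : (a * b) ^ k * t * ((a * b) ^ k)⁻¹ = b ↔ t = b * (a * b) ^ (2 * k) := by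
      simpa using conj_mul_pow_eq_iff ha hb 0 k t
    have hsnd : b * ((a * b) ^ k * t * ((a * b) ^ k)⁻¹) * b⁻¹ = a ↔
        t = b * (a * b) ^ (2 * k + 1) := by
      rw [mul_inv_eq_iff_eq_mul, ← eq_inv_mul_iff_mul_eq, inv_eq_of_mul_eq_one_left hb, add_comm,
        ← conj_mul_pow_eq_iff ha hb, pow_one]
    rw [pow_succ', Equiv.Perm.mul_apply, ih, Equiv.Perm.mul_apply, signedConj_apply,
      signedConj_apply, mul_add_one, Finset.sum_range_succ, Finset.sum_range_succ]
    simp only [hfst, hsnd, add_assoc]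
    simp only [pow_succ' _ k, mul_inv_rev, mul_assoc]

variable {B W : Type*} [Group W] [DecidableEq W] {M : CoxeterMatrix B} (cs : CoxeterSystem M W)

theorem signedConj_isLiftable : M.IsLiftable fun i => signedConj (cs.simple i) := by
  intro i j
  ext1 ⟨t, e⟩
  rw [signedConj_mul_pow_apply (cs.simple_mul_simple_self i) (cs.simple_mul_simple_self j),
    cs.simple_mul_simple_pow, two_mul, Finset.sum_range_add]
  simp only [pow_add, cs.simple_mul_simple_pow, one_mul, CharTwo.add_self_eq_zero, add_zero,
    inv_one, mul_one, Equiv.Perm.one_apply]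

/-- Tits' action of a Coxeter group on `W × ZMod 2`, extending `signedConj` from the simple
reflections. -/
def signedConjHom : W →* Equiv.Perm (W × ZMod 2) :=
  cs.lift ⟨_, signedConj_isLiftable cs⟩

/-- For a reflection `t`, the side of the wall of `t` on which `x` lies: `0` if it is the side of
the identity, `1` otherwise. -/
def side (x t : W) : ZMod 2 :=
  (signedConjHom cs x⁻¹ (t, 0)).2

theorem signedConjHom_simple (i : B) :
    signedConjHom cs (cs.simple i) = signedConj (cs.simple i) :=
  cs.lift_apply_simple (signedConj_isLiftable cs) i

theorem signedConjHom_apply (x t : W) (e : ZMod 2) :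
    signedConjHom cs x (t, e) = (x * t * x⁻¹, e + side cs x⁻¹ t) := by
  have haffine : ∀ e, signedConjHom cs x (t, e) =
      (x * t * x⁻¹, e + (signedConjHom cs x (t, 0)).2) := by
    induction x using cs.simple_induction_left with
    | one => simp
    | mul_simple_left w i ih =>
      intro e
      rw [map_mul, Equiv.Perm.mul_apply, Equiv.Perm.mul_apply, ih e, ih 0, signedConjHom_simple,
        signedConj_apply, signedConj_apply]
      simp only [mul_assoc, mul_inv_rev, add_assoc, zero_add]
  rw [haffine, side, inv_inv]

theorem side_one (t : W) : side cs 1 t = 0 := by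
  simp [side]

theorem side_mul (x y t : W) : side cs (x * y) t = side cs x t + side cs y (x⁻¹ * t * x) := by
  rw [side, mul_inv_rev, map_mul, Equiv.Perm.mul_apply, signedConjHom_apply, signedConjHom_apply]
  simp only [inv_inv, zero_add]

theorem side_simple (i : B) (t : W) :
    side cs (cs.simple i) t = if t = cs.simple i then 1 else 0 := by
  simp [side, signedConjHom_simple, signedConj_apply]

theorem side_mul_simple (x t : W) (i : B) :
    side cs (x * cs.simple i) t =
      side cs x t + if t = x * cs.simple i * x⁻¹ then 1 else 0 := by
  rw [side_mul, side_simple]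
  congr 2
  rw [eq_mul_inv_iff_mul_eq, mul_assoc, inv_mul_eq_iff_eq_mul]

theorem side_self {t : W} (ht : cs.IsReflection t) : side cs t t = 1 := by
  obtain ⟨w, i, rfl⟩ := ht
  have hcancel := side_mul cs w w⁻¹ (w * cs.simple i * w⁻¹)
  rw [mul_inv_cancel, side_one] at hcancel
  have hconj : (w * cs.simple i)⁻¹ * (w * cs.simple i * w⁻¹) * (w * cs.simple i) =
      w⁻¹ * (w * cs.simple i * w⁻¹) * w := by simp [mul_assoc]
  rw [side_mul, side_mul_simple, if_pos rfl, add_right_comm, hconj, ← hcancel, zero_add]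

end Reflections

open NormedSpace Matrix

section MatrixExponential

variable {ι : Type*} [Fintype ι] [DecidableEq ι]

open scoped Matrix.Norms.Operator in
theorem hasSum_exp_mulVec (A : Matrix ι ι ℝ) (v : ι → ℝ) :
    HasSum (fun n : ℕ => (n.factorial : ℝ)⁻¹ • (A ^ n *ᵥ v)) (exp A *ᵥ v) := by
  have hcont : Continuous ((mulVecBilin ℝ ℝ).flip v : Matrix ι ι ℝ → ι → ℝ) := by
    change Continuous fun B : Matrix ι ι ℝ => B *ᵥ v
    fun_prop
  have hseries : HasSum (fun n : ℕ => ((n.factorial : ℝ)⁻¹ • A ^ n) *ᵥ v) (exp A *ᵥ v) :=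
    (exp_series_hasSum_exp' (𝕂 := ℝ) A).map ((mulVecBilin ℝ ℝ).flip v) hcont
  simpa only [smul_mulVec] using hseries

theorem exp_mulVec_sub_mem (K : ProperCone ℝ (ι → ℝ)) {A : Matrix ι ι ℝ}
    (hA : ∀ v ∈ K, A *ᵥ v ∈ K) {v : ι → ℝ} (hv : v ∈ K) : exp A *ᵥ v - v ∈ K := by
  have hpow : ∀ n : ℕ, A ^ n *ᵥ v ∈ K := by
    intro n
    induction n with
    | zero => rwa [pow_zero, one_mulVec]
    | succ n ih =>
      rw [pow_succ', ← mulVec_mulVec]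
      exact hA _ ih
  have htail : HasSum (fun n : ℕ => ((n + 1).factorial : ℝ)⁻¹ • (A ^ (n + 1) *ᵥ v))
      (exp A *ᵥ v - v) := by
    simpa using (hasSum_nat_add_iff' 1).2 (hasSum_exp_mulVec A v)
  exact K.isClosed.mem_of_tendsto htail (.of_forall fun s =>
    K.toSubmodule.sum_mem fun n _ => K.smul_mem (hpow _) (by positivity))

theorem exp_add_smul_one (A : Matrix ι ι ℝ) (a : ℝ) : exp (A + a • 1) = Real.exp a • exp A := by
  have hdiag : exp (a • (1 : Matrix ι ι ℝ)) = Real.exp a • 1 := by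
    rw [smul_one_eq_diagonal, exp_diagonal, smul_one_eq_diagonal, Pi.exp_def, Real.exp_eq_exp_ℝ]
  rw [exp_add_of_commute _ _ ((Commute.one_right A).smul_right a), hdiag, mul_smul_comm, mul_one]

theorem exp_smul_exp_mulVec_sub_mem (K : ProperCone ℝ (ι → ℝ)) {A : Matrix ι ι ℝ} {a : ℝ}
    (hA : ∀ v ∈ K, A *ᵥ v + a • v ∈ K) {v : ι → ℝ} (hv : v ∈ K) :
    Real.exp a • (exp A *ᵥ v) - v ∈ K := by
  rw [← smul_mulVec, ← exp_add_smul_one]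
  refine exp_mulVec_sub_mem K (fun w hw => ?_) hv
  rw [add_mulVec, smul_mulVec, one_mulVec]
  exact hA w hw

theorem exp_mulVec_mem (K : ProperCone ℝ (ι → ℝ)) {A : Matrix ι ι ℝ} {a : ℝ}
    (hA : ∀ v ∈ K, A *ᵥ v + a • v ∈ K) {v : ι → ℝ} (hv : v ∈ K) : exp A *ᵥ v ∈ K := by
  have hmem : Real.exp a • (exp A *ᵥ v) ∈ K := by
    simpa using K.toSubmodule.add_mem (exp_smul_exp_mulVec_sub_mem K hA hv) hv
  simpa [smul_smul, ← Real.exp_add] using K.smul_mem hmem (Real.exp_pos (-a)).le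

open scoped Matrix.Norms.Operator in
theorem hasDerivAt_exp_smul_mulVec (A : Matrix ι ι ℝ) (v : ι → ℝ) (u : ℝ) :
    HasDerivAt (fun u : ℝ => exp (u • A) *ᵥ v) (A *ᵥ (exp (u • A) *ᵥ v)) u := by
  have hexp := hasDerivAt_exp_smul_const' (𝕂 := ℝ) A u
  rw [mulVec_mulVec]
  exact (((mulVecBilin ℝ ℝ).flip v).toContinuousLinearMap.hasFDerivAt
    (x := exp (u • A))).comp_hasDerivAt u hexp

theorem hasDerivAt_exp_smul_mulVec_dotProduct {A : Matrix ι ι ℝ} (hA : A.IsSymm)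
    (B : Matrix ι ι ℝ) (v w : ι → ℝ) (t u : ℝ) :
    HasDerivAt (fun u : ℝ => (exp (u • A) *ᵥ v) ⬝ᵥ (exp ((t - u) • B) *ᵥ w))
      ((exp (u • A) *ᵥ v) ⬝ᵥ ((A - B) *ᵥ (exp ((t - u) • B) *ᵥ w))) u := by
  have hleft := hasDerivAt_exp_smul_mulVec A v u
  have hright : HasDerivAt (fun u : ℝ => exp ((t - u) • B) *ᵥ w)
      (-(B *ᵥ (exp ((t - u) • B) *ᵥ w))) u := by
    have hcomp := (hasDerivAt_exp_smul_mulVec B w (t - u)).scomp u ((hasDerivAt_id u).const_sub t)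
    rwa [neg_one_smul] at hcomp
  have hprod := HasDerivAt.fun_sum (u := Finset.univ) fun i _ =>
    (hasDerivAt_pi.1 hleft i).mul (hasDerivAt_pi.1 hright i)
  refine hprod.congr_deriv ?_
  calc ∑ i, ((A *ᵥ (exp (u • A) *ᵥ v)) i * (exp ((t - u) • B) *ᵥ w) i +
        (exp (u • A) *ᵥ v) i * (-(B *ᵥ (exp ((t - u) • B) *ᵥ w))) i)
      = (A *ᵥ (exp (u • A) *ᵥ v)) ⬝ᵥ (exp ((t - u) • B) *ᵥ w) +
        (exp (u • A) *ᵥ v) ⬝ᵥ (-(B *ᵥ (exp ((t - u) • B) *ᵥ w))) := Finset.sum_add_distrib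
    _ = (exp (u • A) *ᵥ v) ⬝ᵥ ((A - B) *ᵥ (exp ((t - u) • B) *ᵥ w)) := by
      rw [sub_mulVec, dotProduct_sub, dotProduct_mulVec _ A, ← mulVec_transpose, hA.eq,
        dotProduct_neg, ← sub_eq_add_neg]

end MatrixExponential

section Generator

/-- The Dirichlet form of the walk with rates `r`: the form `-⟨f, Q g⟩` of its generator `Q`,
written as a sum over the edges of the Cayley graph, each of which is counted from both ends. -/
noncomputable def dirichletForm {B W : Type*} [Group W] [Fintype B] [Fintype W]
    {M : CoxeterMatrix B} (cs : CoxeterSystem M W) (r : B → ℝ) (f g : W → ℝ) : ℝ :=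
  ∑ s, r s / 2 * ∑ x, (f x - f (x * cs.simple s)) * (g x - g (x * cs.simple s))

theorem sum_mul_right_mul_sub_eq_neg {G : Type*} [Group G] [Fintype G] {s : G} (hs : s * s = 1)
    (f g : G → ℝ) : ∑ x, f (x * s) * (g x - g (x * s)) = -∑ x, f x * (g x - g (x * s)) := by
  rw [← Equiv.sum_comp (Equiv.mulRight s), ← Finset.sum_neg_distrib]
  refine Finset.sum_congr rfl fun x _ => ?_
  rw [Equiv.coe_mulRight, mul_assoc, hs, mul_one, ← mul_neg, neg_sub]

variable {B W : Type*} [Group W] [Fintype B] [DecidableEq W] {M : CoxeterMatrix B}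
  (cs : CoxeterSystem M W)

theorem generator_isSymm (r : B → ℝ) : (generator cs r).IsSymm := by
  ext x y
  have hedge (s : B) : x = y * cs.simple s ↔ y = x * cs.simple s := by
    constructor <;> rintro rfl <;> simp
  simp only [transpose_apply, generator, of_apply, hedge, eq_comm (a := x) (b := y)]

theorem generator_sub (r r' : B → ℝ) :
    generator cs (r - r') = generator cs r - generator cs r' := by
  ext x y
  simp only [generator, of_apply, Matrix.sub_apply, Pi.sub_apply, sub_mul, Finset.sum_sub_distrib]

variable [Fintype W]

theorem generator_mulVec (r : B → ℝ) (f : W → ℝ) (x : W) :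
    (generator cs r *ᵥ f) x = ∑ s, r s * (f (x * cs.simple s) - f x) := by
  simp only [mulVec, dotProduct, generator, of_apply, Finset.sum_mul]
  rw [Finset.sum_comm]
  refine Finset.sum_congr rfl fun s _ => ?_
  simp [mul_assoc, ← Finset.mul_sum, sub_mul, Finset.sum_sub_distrib]

theorem dotProduct_generator_mulVec (r : B → ℝ) (f g : W → ℝ) :
    f ⬝ᵥ (generator cs r *ᵥ g) = -dirichletForm cs r f g := by
  simp only [dirichletForm, sub_mul (f _), Finset.sum_sub_distrib,
    sum_mul_right_mul_sub_eq_neg (cs.simple_mul_simple_self _)]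
  simp only [dotProduct, generator_mulVec, Finset.mul_sum, ← Finset.sum_neg_distrib,
    ← Finset.sum_sub_distrib]
  rw [Finset.sum_comm]
  refine Finset.sum_congr rfl fun s _ => Finset.sum_congr rfl fun x _ => ?_
  ring

theorem transProb_one_eq (r : B → ℝ) (t : ℝ) :
    transProb cs r t 1 = exp (t • generator cs r) *ᵥ Pi.single 1 1 := by
  ext y
  rw [mulVec_single_one]
  exact ((generator_isSymm cs r).smul t).exp.apply y 1

theorem transProb_dotProduct (r : B → ℝ) (t : ℝ) (x : W) (f : W → ℝ) :
    transProb cs r t x ⬝ᵥ f = (exp (t • generator cs r) *ᵥ f) x := rfl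

section Cone

variable {K : ProperCone ℝ (W → ℝ)}
  (hK : ∀ s, ∀ f ∈ K, (fun x => f (x * cs.simple s) + f x) ∈ K)
  {r : B → ℝ} (hr : ∀ s, 0 ≤ r s) {t : ℝ} (ht : 0 ≤ t) {f : W → ℝ} (hf : f ∈ K)

include hK hr ht hf

-- Adding a multiple of the identity turns `Q` into a nonnegative combination of the operators
-- `1 + R_s`, where `R_s` is the right translation by `s`.
theorem smul_generator_mulVec_add_mem :
    (t • generator cs r) *ᵥ f + (t * (2 * ∑ s, r s)) • f ∈ K := by
  have hsum : (t • generator cs r) *ᵥ f + (t * (2 * ∑ s, r s)) • f =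
      ∑ s, (t * r s) • fun x => f (x * cs.simple s) + f x := by
    ext x
    simp only [smul_mulVec, Pi.add_apply, Pi.smul_apply, smul_eq_mul, generator_mulVec,
      Finset.sum_apply, Finset.mul_sum, Finset.sum_mul, ← Finset.sum_add_distrib]
    refine Finset.sum_congr rfl fun s _ => ?_
    ring
  rw [hsum]
  exact K.toSubmodule.sum_mem fun s _ => K.smul_mem (hK s f hf) (mul_nonneg ht (hr s))

theorem exp_smul_exp_generator_mulVec_sub_mem :
    Real.exp (t * (2 * ∑ s, r s)) • (exp (t • generator cs r) *ᵥ f) - f ∈ K :=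
  exp_smul_exp_mulVec_sub_mem K (fun _ => smul_generator_mulVec_add_mem cs hK hr ht) hf

theorem exp_generator_mulVec_mem : exp (t • generator cs r) *ᵥ f ∈ K :=
  exp_mulVec_mem K (fun _ => smul_generator_mulVec_add_mem cs hK hr ht) hf

end Cone

theorem transProb_nonneg {r : B → ℝ} (hr : ∀ s, 0 ≤ r s) {t : ℝ} (ht : 0 ≤ t) (x : W) :
    0 ≤ transProb cs r t 1 x := by
  have hmem : transProb cs r t 1 ∈ ProperCone.positive ℝ (W → ℝ) := by
    rw [transProb_one_eq]
    refine exp_generator_mulVec_mem cs (fun s f hf => ?_) hr ht ?_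
    · rw [ProperCone.mem_positive] at hf ⊢
      exact fun x => add_nonneg (hf _) (hf x)
    · exact (ProperCone.mem_positive ..).2 (Pi.single_nonneg.2 zero_le_one)
  exact (ProperCone.mem_positive ..).1 hmem x

end Generator

section Decreasing

variable {B W : Type*} [Group W] [DecidableEq W] {M : CoxeterMatrix B} (cs : CoxeterSystem M W)

/-- The closed convex cone of the functions on `W` that decrease in the Bruhat order, that is, that
do not increase when their argument is reflected away from the identity. -/
def decreasingCone : ProperCone ℝ (W → ℝ) where
  carrier := {f | ∀ t x, cs.IsReflection t → side cs x t = 0 → f (t * x) ≤ f x}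
  add_mem' hf hg t x ht hx := add_le_add (hf t x ht hx) (hg t x ht hx)
  zero_mem' _ _ _ _ := le_rfl
  smul_mem' c _ hf t x ht hx := mul_le_mul_of_nonneg_left (hf t x ht hx) c.2
  isClosed' := by
    simp only [Set.ofPred_forall]
    exact isClosed_iInter fun t => isClosed_iInter fun x => isClosed_iInter fun _ =>
      isClosed_iInter fun _ => isClosed_le (continuous_apply _) (continuous_apply _)

variable {cs}

theorem mem_decreasingCone {f : W → ℝ} :
    f ∈ decreasingCone cs ↔ ∀ t x, cs.IsReflection t → side cs x t = 0 → f (t * x) ≤ f x :=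
  Iff.rfl

theorem comp_mem_decreasingCone {f : W → ℝ} (hf : f ∈ decreasingCone cs) {ψ : ℝ → ℝ}
    (hψ : Monotone ψ) : (fun x => ψ (f x)) ∈ decreasingCone cs :=
  fun t x ht hx => hψ (hf t x ht hx)

-- Unless `t` swaps the points `x` and `x * s`, they lie on the same side of its wall.
theorem add_mul_simple_mem_decreasingCone (s : B) {f : W → ℝ} (hf : f ∈ decreasingCone cs) :
    (fun x => f (x * cs.simple s) + f x) ∈ decreasingCone cs := by
  intro t x ht hx
  have hside := side_mul_simple cs x t s
  by_cases hts : t = x * cs.simple s * x⁻¹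
  · have htx : t * x = x * cs.simple s := by rw [hts, inv_mul_cancel_right]
    simp only [htx, cs.simple_mul_simple_cancel_right, add_comm, le_refl]
  · rw [if_neg hts, add_zero, hx] at hside
    simp only [mul_assoc]
    exact add_le_add (hf t _ ht hside) (hf t x ht hx)

theorem single_one_mem_decreasingCone : (Pi.single 1 1 : W → ℝ) ∈ decreasingCone cs := by
  intro t x ht hx
  have hne : t * x ≠ 1 := by
    intro h
    rw [eq_inv_of_mul_eq_one_right h, ht.inv, side_self cs ht] at hx
    exact one_ne_zero hx
  have hnonneg : (0 : W → ℝ) ≤ Pi.single 1 1 := Pi.single_nonneg.2 zero_le_one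
  rw [Pi.single_eq_of_ne hne]
  exact hnonneg x

variable {f g : W → ℝ}

theorem mul_sub_nonneg_of_mem_decreasingCone (hf : f ∈ decreasingCone cs)
    (hg : g ∈ decreasingCone cs) (x : W) (s : B) :
    0 ≤ (f x - f (x * cs.simple s)) * (g x - g (x * cs.simple s)) := by
  have of_side_eq_zero (y : W) (hy : side cs y (y * cs.simple s * y⁻¹) = 0) :
      0 ≤ (f y - f (y * cs.simple s)) * (g y - g (y * cs.simple s)) := by
    have hle {h : W → ℝ} (hh : h ∈ decreasingCone cs) : h (y * cs.simple s) ≤ h y := by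
      simpa only [inv_mul_cancel_right] using hh _ y ⟨y, s, rfl⟩ hy
    exact mul_nonneg (sub_nonneg.2 (hle hf)) (sub_nonneg.2 (hle hg))
  have hdich : ∀ a : ZMod 2, a = 0 ∨ a + 1 = 0 := by decide
  rcases hdich (side cs x (x * cs.simple s * x⁻¹)) with hx | hx
  · exact of_side_eq_zero x hx
  · have hflip := of_side_eq_zero (x * cs.simple s) (by simpa [side_mul_simple, mul_assoc] using hx)
    rw [cs.simple_mul_simple_cancel_right] at hflip
    linarith

variable [Fintype B] [Fintype W] {r : B → ℝ} (hr : ∀ s, 0 ≤ r s)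

include hr

theorem dirichletForm_nonneg (hf : f ∈ decreasingCone cs) (hg : g ∈ decreasingCone cs) :
    0 ≤ dirichletForm cs r f g :=
  Finset.sum_nonneg fun s _ => mul_nonneg (div_nonneg (hr s) zero_le_two)
    (Finset.sum_nonneg fun x _ => mul_sub_nonneg_of_mem_decreasingCone hf hg x s)

theorem dirichletForm_pos (hf : f ∈ decreasingCone cs) (hg : g ∈ decreasingCone cs) {s : B}
    (hs : 0 < r s) (hfs : f (cs.simple s) < f 1) (hgs : g (cs.simple s) < g 1) :
    0 < dirichletForm cs r f g := by
  have hnonneg := mul_sub_nonneg_of_mem_decreasingCone hf hg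
  have hone : 0 < (f 1 - f (1 * cs.simple s)) * (g 1 - g (1 * cs.simple s)) := by
    rw [one_mul]
    exact mul_pos (sub_pos.2 hfs) (sub_pos.2 hgs)
  exact Finset.sum_pos'
    (fun i _ => mul_nonneg (div_nonneg (hr i) zero_le_two)
      (Finset.sum_nonneg fun x _ => hnonneg x i))
    ⟨s, Finset.mem_univ s, mul_pos (half_pos hs)
      (Finset.sum_pos' (fun x _ => hnonneg x s) ⟨1, Finset.mem_univ 1, hone⟩)⟩

variable {t : ℝ} (ht : 0 ≤ t)

include ht

theorem exp_generator_mulVec_mem_decreasingCone (hf : f ∈ decreasingCone cs) :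
    exp (t • generator cs r) *ᵥ f ∈ decreasingCone cs :=
  exp_generator_mulVec_mem cs (fun s _ => add_mul_simple_mem_decreasingCone s) hr ht hf

theorem exp_generator_mulVec_simple_lt (hf : f ∈ decreasingCone cs) {s : B}
    (hfs : f (cs.simple s) < f 1) :
    (exp (t • generator cs r) *ᵥ f) (cs.simple s) < (exp (t • generator cs r) *ᵥ f) 1 := by
  have hle := mem_decreasingCone.1
    (exp_smul_exp_generator_mulVec_sub_mem cs (fun s _ => add_mul_simple_mem_decreasingCone s)
      hr ht hf) (cs.simple s) 1 (cs.isReflection_simple s) (side_one cs _)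
  simp only [mul_one, Pi.sub_apply, Pi.smul_apply, smul_eq_mul] at hle
  refine lt_of_mul_lt_mul_left ?_ (Real.exp_pos (t * (2 * ∑ s, r s))).le
  linarith

theorem transProb_mem_decreasingCone : transProb cs r t 1 ∈ decreasingCone cs := by
  rw [transProb_one_eq]
  exact exp_generator_mulVec_mem_decreasingCone hr ht single_one_mem_decreasingCone

theorem transProb_simple_lt (s : B) : transProb cs r t 1 (cs.simple s) < transProb cs r t 1 1 := by
  rw [transProb_one_eq]
  refine exp_generator_mulVec_simple_lt hr ht single_one_mem_decreasingCone ?_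
  have hne : cs.simple s ≠ 1 := fun h => by simpa [h] using cs.length_simple s
  rw [Pi.single_eq_same, Pi.single_eq_of_ne hne]
  exact one_pos

end Decreasing

section Comparison

variable {B W : Type*} [Group W] [Fintype B] [Fintype W] [DecidableEq W] {M : CoxeterMatrix B}

-- The pairing belongs to the walk that runs at rates `r` up to time `u` and at rates `r'` from then
-- on.
theorem hasDerivAt_transProb_dotProduct (cs : CoxeterSystem M W) (r r' : B → ℝ) (c : W → ℝ)
    (t u : ℝ) :
    HasDerivAt (fun u => transProb cs r u 1 ⬝ᵥ (exp ((t - u) • generator cs r') *ᵥ c))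
      (dirichletForm cs (r' - r) (transProb cs r u 1) (exp ((t - u) • generator cs r') *ᵥ c))
      u := by
  have hderiv := hasDerivAt_exp_smul_mulVec_dotProduct (generator_isSymm cs r)
    (generator cs r') (Pi.single 1 1) c t u
  simp only [← transProb_one_eq] at hderiv
  rwa [← neg_sub (generator cs r'), ← generator_sub, neg_mulVec, dotProduct_neg,
    dotProduct_generator_mulVec, neg_neg] at hderiv

theorem transProb_zero_dotProduct (cs : CoxeterSystem M W) (r : B → ℝ) (f : W → ℝ) (x : W) :
    transProb cs r 0 x ⬝ᵥ f = f x := by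
  rw [transProb_dotProduct, zero_smul, exp_zero, one_mulVec]

variable {cs : CoxeterSystem M W} {r r' : B → ℝ} (hr : ∀ s, 0 ≤ r s) (hrr' : ∀ s, r s ≤ r' s)
  {t : ℝ} {c : W → ℝ} (hc : c ∈ decreasingCone cs)

include hr hrr' hc

theorem transProb_dotProduct_le (ht : 0 ≤ t) :
    transProb cs r' t 1 ⬝ᵥ c ≤ transProb cs r t 1 ⬝ᵥ c := by
  have hr' : ∀ s, 0 ≤ r' s := fun s => (hr s).trans (hrr' s)
  have hderiv := hasDerivAt_transProb_dotProduct cs r r' c t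
  have hmono := monotoneOn_of_hasDerivWithinAt_nonneg (convex_Icc 0 t)
    (fun u _ => (hderiv u).continuousAt.continuousWithinAt)
    (fun u _ => (hderiv u).hasDerivWithinAt) fun u hu => by
      rw [interior_Icc] at hu
      exact dirichletForm_nonneg (fun s => sub_nonneg.2 (hrr' s))
        (transProb_mem_decreasingCone hr hu.1.le)
        (exp_generator_mulVec_mem_decreasingCone hr' (sub_nonneg.2 hu.2.le) hc)
  simpa only [transProb_zero_dotProduct, sub_zero, sub_self, zero_smul, exp_zero, one_mulVec,
    ← transProb_dotProduct] using hmono (Set.left_mem_Icc.2 ht) (Set.right_mem_Icc.2 ht) ht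

theorem transProb_dotProduct_lt (ht : 0 < t) {s : B} (hs : r s < r' s)
    (hcs : c (cs.simple s) < c 1) : transProb cs r' t 1 ⬝ᵥ c < transProb cs r t 1 ⬝ᵥ c := by
  have hr' : ∀ s, 0 ≤ r' s := fun s => (hr s).trans (hrr' s)
  have hderiv := hasDerivAt_transProb_dotProduct cs r r' c t
  have hmono := strictMonoOn_of_hasDerivWithinAt_pos (convex_Icc 0 t)
    (fun u _ => (hderiv u).continuousAt.continuousWithinAt)
    (fun u _ => (hderiv u).hasDerivWithinAt) fun u hu => by
      rw [interior_Icc] at hu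
      have hut : 0 ≤ t - u := sub_nonneg.2 hu.2.le
      exact dirichletForm_pos (fun s => sub_nonneg.2 (hrr' s))
        (transProb_mem_decreasingCone hr hu.1.le)
        (exp_generator_mulVec_mem_decreasingCone hr' hut hc) (sub_pos.2 hs)
        (transProb_simple_lt hr hu.1.le s) (exp_generator_mulVec_simple_lt hr' hut hc hcs)
  simpa only [transProb_zero_dotProduct, sub_zero, sub_self, zero_smul, exp_zero, one_mulVec,
    ← transProb_dotProduct] using hmono (Set.left_mem_Icc.2 ht.le) (Set.right_mem_Icc.2 ht.le) ht

omit hc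

theorem majorizes_transProb (ht : 0 ≤ t) :
    Majorizes (transProb cs r t 1) (transProb cs r' t 1) := by
  have hr' : ∀ s, 0 ≤ r' s := fun s => (hr s).trans (hrr' s)
  exact majorizes_of_forall_monotone fun ψ hψ => transProb_dotProduct_le hr hrr'
    (comp_mem_decreasingCone (transProb_mem_decreasingCone hr' ht) hψ) ht

theorem sum_sq_transProb_lt (ht : 0 < t) (hne : r ≠ r') :
    ∑ x, transProb cs r' t 1 x ^ 2 < ∑ x, transProb cs r t 1 x ^ 2 := by
  have hr' : ∀ s, 0 ≤ r' s := fun s => (hr s).trans (hrr' s)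
  obtain ⟨s, hs⟩ : ∃ s, r s < r' s := (Pi.lt_def.1 (lt_of_le_of_ne hrr' hne)).2
  have hlt := transProb_dotProduct_lt (cs := cs) hr hrr' (transProb_mem_decreasingCone hr' ht.le) ht
    hs (transProb_simple_lt hr' ht.le s)
  have hamgm : 2 * (transProb cs r t 1 ⬝ᵥ transProb cs r' t 1) ≤
      ∑ x, transProb cs r t 1 x ^ 2 + ∑ x, transProb cs r' t 1 x ^ 2 := by
    rw [dotProduct, Finset.mul_sum, ← Finset.sum_add_distrib]
    refine Finset.sum_le_sum fun x _ => ?_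
    rw [← mul_assoc]
    exact two_mul_le_add_sq _ _
  have hself : transProb cs r' t 1 ⬝ᵥ transProb cs r' t 1 = ∑ x, transProb cs r' t 1 x ^ 2 :=
    Finset.sum_congr rfl fun x _ => (sq _).symm
  linarith

theorem strictlyMajorizes_transProb (ht : 0 < t) (hne : r ≠ r') :
    StrictlyMajorizes (transProb cs r t 1) (transProb cs r' t 1) :=
  (majorizes_transProb hr hrr' ht.le).strictlyMajorizes_of_sum_lt even_two.convexOn_pow
    (sum_sq_transProb_lt hr hrr' ht hne)

end Comparison

end CoxeterWalk

theorem theoremt {B W : Type*} [Group W] [Fintype B] [Fintype W] [DecidableEq W]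
    {M : CoxeterMatrix B} (cs : CoxeterSystem M W) (r r' : B → ℝ)
    (hr : ∀ s, 0 ≤ r s) (hrr' : ∀ s, r s ≤ r' s) (t : ℝ) (ht : 0 < t) :
    -- majorization, strict when the rates differ
    Majorizes (transProb cs r t 1) (transProb cs r' t 1) ∧
    (r ≠ r' → StrictlyMajorizes (transProb cs r t 1) (transProb cs r' t 1)) ∧
    -- consequences for the distances to uniform and for the entropy
    (∀ p : ℝ, 1 ≤ p →
      lpDist p (transProb cs r' t 1) (uniform W) ≤ lpDist p (transProb cs r t 1) (uniform W)) ∧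
    linftyDist (transProb cs r' t 1) (uniform W) ≤
      linftyDist (transProb cs r t 1) (uniform W) ∧
    hellingerDist (transProb cs r' t 1) (uniform W) ≤
      hellingerDist (transProb cs r t 1) (uniform W) ∧
    entropy (transProb cs r t 1) ≤ entropy (transProb cs r' t 1) ∧
    -- the consequences that come from a strictly convex function are strict
    (r ≠ r' →
      (∀ p : ℝ, 1 < p →
        lpDist p (transProb cs r' t 1) (uniform W) <
          lpDist p (transProb cs r t 1) (uniform W)) ∧
      hellingerDist (transProb cs r' t 1) (uniform W) <
        hellingerDist (transProb cs r t 1) (uniform W) ∧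
      entropy (transProb cs r t 1) < entropy (transProb cs r' t 1)) := by
  have hr' : ∀ s, 0 ≤ r' s := fun s => (hr s).trans (hrr' s)
  have hf := transProb_nonneg cs hr ht.le
  have hg := transProb_nonneg cs hr' ht.le
  have hmaj := majorizes_transProb (cs := cs) hr hrr' ht.le
  refine ⟨hmaj, strictlyMajorizes_transProb hr hrr' ht, fun p hp => hmaj.lpDist_le hp _,
    hmaj.linftyDist_le _, hmaj.hellingerDist_le hf hg _, hmaj.entropy_le hf hg, fun hne => ?_⟩
  have hstrict := strictlyMajorizes_transProb (cs := cs) hr hrr' ht hne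
  have hpos : (0 : ℝ) < 1 / Fintype.card W := by positivity
  exact ⟨fun p hp => hstrict.lpDist_lt hp _, hstrict.hellingerDist_lt hf hg hpos,
    hstrict.entropy_lt hf hg⟩
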